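/- Conventions. Let $\tau$ be a first-order vocabulary and $V$ a set of variables, of arbitrary cardinality. Structures are nonempty. A team of a $\tau$-structure $\mathcal M$ with domain $D\subseteq V$ is a set $X$ of maps $s\colon D\to\mathcal M$; for $E\subseteq D$ put $X\restriction E=\{s\restriction E\mid s\in X\}$, and for $v_0,\dots,v_{n-1}\in D$ put $X[v_0,\dots,v_{n-1}]=\{(s(v_0),\dots,s(v_{n-1}))\mid s\in X\}$. A logic over team semantics $\mathcal L$ (for $\tau$ and $V$) consists of a set of formulas $\phi$, each with a finite set $\mathrm{Fv}(\phi)\subseteq V$ of free variables, and a relation $\mathcal M\models_X\phi$, for $\tau$-structures $\mathcal M$ and teams $X$ of $\mathcal M$ whose domain contains $\mathrm{Fv}(\phi)$. $\mathcal L$ is local if $\mathcal M\models_X\phi\iff\mathcal M\models_{X\restriction\mathrm{Fv}(\phi)}\phi$ always. $\mathcal L$ admits a translation into existential second-order logic (ESO) if for every formula $\phi$ with $\mathrm{Fv}(\phi)=\{v_0,\dots,v_{n-1}\}$ ($v_i$ distinct) there is an ESO sentence $\chi(R)=\exists R^1\cdots\exists R^m\,\alpha$, where $R$ is a fresh $n$-ary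 relation symbol, the $R^i$ are fresh relation symbols and $\alpha$ is a first-order sentence in the vocabulary $\tau\cup\{R,R^1,\dots,R^m\}$, such that for all $\mathcal M$ and $X$, $$\mathcal M\models_X\phi\iff(\mathcal M,X[v_0,\dots,v_{n-1}])\models\chi(R).$$ A set $\Gamma$ of formulas is satisfiable if there are a structure $\mathcal M$ and a nonempty team $X$ of $\mathcal M$, with domain containing the free variables of all formulas in $\Gamma$, such that $\mathcal M\models_X\phi$ for all $\phi\in\Gamma$; it is finitely satisfiable if each of its finite subsets is satisfiable. Theorem (Compactness). Let $\mathcal L$ be a logic over team semantics that is local and admits a translation into ESO. Then every finitely satisfiable set of formulas of $\mathcal L$, with arbitrarily many free variables, is satisfiable. Moreover, let $C$ be any set of dependency atoms among the dependence atoms $=\!(\vec x,y)$, independence atoms $\vec x\perp_{\vec z}\vec y$, inclusion atoms $\vec x\subseteq\vec y$ and exclusion atoms $\vec x\mid\vec y$, and let $\mathrm{FO}(C)$ be the logic whose formulas are built from first-order literals and atoms of the kinds in $C$ by $\wedge,\vee,\exists,\forall$, with lax team semantics. Then $\mathrm{FO}(C)$, and likewise its restriction to any subset of its formulas, is local and admits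 a translation into ESO; consequently every finitely satisfiable set of its formulas is satisfiable. This includes independence logic $\mathrm{FO}(\perp_c)$ and its fragments, in particular dependence, inclusion and exclusion logic. -/

import Mathlib

open FirstOrder

universe u

namespace TeamSemantics

/-! ### Teams

An assignment of `M` with domain `D ⊆ V` is a map `D → M`; a team of `M` with domain `D` is a set
of such assignments. -/

section Teams

variable {V M : Type u}

/-- The team `X ↾ E = {s ↾ E | s ∈ X}`, for `E ⊆ dom X`. -/
def restrictTeam {D E : Set V} (h : E ⊆ D) (X : Set (D → M)) : Set (E → M) :=
  (fun s => s ∘ Set.inclusion h) '' X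

/-- The relation `X[v₀, …, vₙ₋₁] = {(s v₀, …, s vₙ₋₁) | s ∈ X}`. -/
def teamRel {D : Set V} (X : Set (D → M)) {n : ℕ} (v : Fin n → V) (h : ∀ i, v i ∈ D) :
    Set (Fin n → M) :=
  (fun s i => s ⟨v i, h i⟩) '' X

open Classical in
/-- The assignment `s(a/x)`, with domain `D ∪ {x}`. -/
noncomputable def updateAssignment {D : Set V} (s : D → M) (x : V) (a : M) :
    ↥(insert x D : Set V) → M :=
  fun y => if h : (y : V) = x then a else s ⟨y, y.2.resolve_left h⟩

/-- The supplemented team `X(F/x) = {s(a/x) | s ∈ X, a ∈ F s}`. -/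
def supplementTeam {D : Set V} (X : Set (D → M)) (x : V) (F : X → Set M) :
    Set (↥(insert x D : Set V) → M) :=
  {s' | ∃ s : X, ∃ a ∈ F s, s' = updateAssignment s.1 x a}

/-- The duplicate team `X(M/x) = {s(a/x) | s ∈ X, a ∈ M}`. -/
def duplicateTeam {D : Set V} (X : Set (D → M)) (x : V) : Set (↥(insert x D : Set V) → M) :=
  {s' | ∃ s ∈ X, ∃ a : M, s' = updateAssignment s x a}

open Classical in
/-- The value of a variable under an assignment `s : D → M`. It is `s v` for `v ∈ D`; formulas are
only ever evaluated in teams whose domain contains their free variables, so that the default value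
outside `D` plays no role. -/
noncomputable def value [Nonempty M] {D : Set V} (s : D → M) (v : V) : M :=
  if h : v ∈ D then s ⟨v, h⟩ else Classical.arbitrary M

end Teams

/-! ### Existential second-order logic -/

/-- The vocabulary with relation symbols `i : ι` of arities `arity i`, and no function symbols. -/
def relLang {ι : Type} (arity : ι → ℕ) : FirstOrder.Language.{0, 0} where
  Functions := fun _ => Empty
  Relations := fun k => {i : ι // arity i = k}

/-- The interpretation of the symbols of `relLang arity` by given relations on `M`. -/
@[reducible] def relStructure {ι : Type} (arity : ι → ℕ) {M : Type u}
    (S : ∀ i, Set (Fin (arity i) → M)) : (relLang arity).Structure M where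
  funMap := fun f _ => f.elim
  RelMap := fun r xs => (fun j => xs (Fin.cast r.2 j)) ∈ S r.1

/-- Sentences `∃ S₀ … ∃ Sₘ₋₁ α` of existential second-order logic in the vocabulary `L`, with `α` a
first-order sentence in `L ∪ {S₀, …, Sₘ₋₁}`, where `Sᵢ` is a fresh relation symbol of arity
`arity i`. -/
structure ESOSentence (L : FirstOrder.Language.{u, u}) where
  /-- the number of quantified relation symbols -/
  num : ℕ
  /-- the arities of the quantified relation symbols -/
  arity : Fin num → ℕ
  /-- the first-order part -/
  matrix : (L.sum (relLang arity)).Sentence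

/-- Truth of an existential second-order sentence (in full semantics) in a structure. -/
def ESOSentence.Holds {L : FirstOrder.Language.{u, u}} (χ : ESOSentence L)
    (M : Type u) [L.Structure M] :
    Prop :=
  ∃ S : ∀ i, Set (Fin (χ.arity i) → M),
    letI : (relLang χ.arity).Structure M := relStructure χ.arity S
    M ⊨ χ.matrix

/-- The vocabulary `L ∪ {R}`, with `R` a fresh `n`-ary relation symbol. -/
abbrev withRel (L : FirstOrder.Language.{u, u}) (n : ℕ) : FirstOrder.Language.{u, u} :=
  L.sum (relLang (fun _ : Unit => n))

/-- `(M, A) ⊨ χ(R)`, where the relation `A` interprets `R`. -/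
def ESOSentence.HoldsWith {L : FirstOrder.Language.{u, u}} {n : ℕ} (χ : ESOSentence (withRel L n))
    (M : Type u) [L.Structure M] (A : Set (Fin n → M)) : Prop :=
  letI : (relLang (fun _ : Unit => n)).Structure M := relStructure _ (fun _ => A)
  χ.Holds M

/-! ### Logics over team semantics -/

/-- A logic over team semantics, in the vocabulary `L` and with variables from `V`: formulas with
finitely many free variables, and a satisfaction relation `M ⊨_X φ` between (nonempty) structures
`M` with a team `X` and formulas `φ`. The relation is only ever used when the domain of `X`
contains the free variables of `φ`. -/
structure TeamLogic (L : FirstOrder.Language.{u, u}) (V : Type u) where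
  /-- the formulas -/
  Form : Type u
  /-- the free variables of a formula -/
  fv : Form → Finset V
  /-- the satisfaction relation -/
  Sat : Form → (M : Type u) → [L.Structure M] → [Nonempty M] → {D : Set V} → Set (D → M) → Prop

namespace TeamLogic

variable {L : FirstOrder.Language.{u, u}} {V : Type u} (𝓛 : TeamLogic L V)

/-- Locality: `M ⊨_X φ` if and only if `M ⊨_{X ↾ Fv(φ)} φ`. -/
def IsLocal : Prop :=
  ∀ (φ : 𝓛.Form) (M : Type u) [L.Structure M] [Nonempty M] (D : Set V)
    (h : (𝓛.fv φ : Set V) ⊆ D) (X : Set (D → M)),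
    𝓛.Sat φ M X ↔ 𝓛.Sat φ M (restrictTeam h X)

/-- Translation into existential second-order logic: for every formula `φ(v₀, …, vₙ₋₁)` there is an
existential second-order sentence `χ(R)`, with `R` a fresh `n`-ary relation symbol, such that
`M ⊨_X φ` if and only if `(M, X[v₀, …, vₙ₋₁]) ⊨ χ(R)`. -/
def TranslatesToESO : Prop :=
  ∀ (φ : 𝓛.Form) (n : ℕ) (v : Fin n → V), Function.Injective v →
    Set.range v = (𝓛.fv φ : Set V) →
    ∃ χ : ESOSentence (withRel L n),
      ∀ (M : Type u) [L.Structure M] [Nonempty M] (D : Set V) (h : ∀ i, v i ∈ D)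
        (X : Set (D → M)),
        𝓛.Sat φ M X ↔ χ.HoldsWith M (teamRel X v h)

/-- A set of formulas is satisfiable if some nonempty team of some structure satisfies all of its
members. -/
def Satisfiable (Γ : Set 𝓛.Form) : Prop :=
  ∃ (M : Type u) (_ : L.Structure M) (_ : Nonempty M) (D : Set V) (X : Set (D → M)),
    X.Nonempty ∧ ∀ φ ∈ Γ, (𝓛.fv φ : Set V) ⊆ D ∧ 𝓛.Sat φ M X

/-- Every finite subset is satisfiable. -/
def FinitelySatisfiable (Γ : Set 𝓛.Form) : Prop :=
  ∀ Γ₀ ⊆ Γ, Γ₀.Finite → 𝓛.Satisfiable Γ₀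

/-- The fragment of a logic given by a set of its formulas. -/
def fragment (F : Set 𝓛.Form) : TeamLogic L V where
  Form := F
  fv := fun φ => 𝓛.fv φ.1
  Sat := fun φ M _ _ _ X => 𝓛.Sat φ.1 M X

end TeamLogic

/-! ### Independence logic and related logics -/

/-- The kinds of dependency atoms. -/
inductive DepAtom : Type
  /-- `=(x⃗, y)` -/
  | dependence
  /-- `x⃗ ⊥_z⃗ y⃗` -/
  | independence
  /-- `x⃗ ⊆ y⃗` -/
  | inclusion
  /-- `x⃗ ∣ y⃗` -/
  | exclusion

/-- Formulas of `FO(C)`: first-order literals and the dependency atoms of the kinds in `C`, closed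
under conjunction, disjunction and the two quantifiers. -/
inductive FOFormula (L : FirstOrder.Language.{u, u}) (V : Type u) (C : Set DepAtom) : Type u
  | eq (t t' : L.Term V)
  | neq (t t' : L.Term V)
  | rel {n : ℕ} (R : L.Relations n) (t : Fin n → L.Term V)
  | nrel {n : ℕ} (R : L.Relations n) (t : Fin n → L.Term V)
  | dep (hC : DepAtom.dependence ∈ C) {n : ℕ} (x : Fin n → V) (y : V)
  | indep (hC : DepAtom.independence ∈ C) {n m k : ℕ} (x : Fin n → V) (z : Fin k → V)
      (y : Fin m → V)
  | incl (hC : DepAtom.inclusion ∈ C) {n : ℕ} (x y : Fin n → V)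
  | excl (hC : DepAtom.exclusion ∈ C) {n : ℕ} (x y : Fin n → V)
  | and (φ ψ : FOFormula L V C)
  | or (φ ψ : FOFormula L V C)
  | ex (x : V) (φ : FOFormula L V C)
  | all (x : V) (φ : FOFormula L V C)

namespace FOFormula

variable {L : FirstOrder.Language.{u, u}} {V : Type u} {C : Set DepAtom}

open Classical in
/-- The free variables of a formula. -/
noncomputable def fv : FOFormula L V C → Finset V
  | eq t t' => t.varFinset ∪ t'.varFinset
  | neq t t' => t.varFinset ∪ t'.varFinset
  | rel _ t => Finset.univ.biUnion fun i => (t i).varFinset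
  | nrel _ t => Finset.univ.biUnion fun i => (t i).varFinset
  | dep _ x y => insert y (Finset.univ.image x)
  | indep _ x z y => Finset.univ.image x ∪ Finset.univ.image z ∪ Finset.univ.image y
  | incl _ x y => Finset.univ.image x ∪ Finset.univ.image y
  | excl _ x y => Finset.univ.image x ∪ Finset.univ.image y
  | and φ ψ => φ.fv ∪ ψ.fv
  | or φ ψ => φ.fv ∪ ψ.fv
  | ex x φ => φ.fv.erase x
  | all x φ => φ.fv.erase x

/-- Lax team semantics. -/
def Sat {M : Type u} [L.Structure M] [Nonempty M] :
    FOFormula L V C → {D : Set V} → Set (D → M) → Prop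
  | eq t t', _, X => ∀ s ∈ X, t.realize (value s) = t'.realize (value s)
  | neq t t', _, X => ∀ s ∈ X, t.realize (value s) ≠ t'.realize (value s)
  | rel R t, _, X =>
      ∀ s ∈ X, FirstOrder.Language.Structure.RelMap R fun i => (t i).realize (value s)
  | nrel R t, _, X =>
      ∀ s ∈ X, ¬ FirstOrder.Language.Structure.RelMap R fun i => (t i).realize (value s)
  | dep _ x y, _, X =>
      ∀ s ∈ X, ∀ s' ∈ X, (∀ i, value s (x i) = value s' (x i)) → value s y = value s' y
  | indep _ x z y, _, X =>
      ∀ s ∈ X, ∀ s' ∈ X, (∀ i, value s (z i) = value s' (z i)) →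
        ∃ s'' ∈ X, (∀ i, value s (x i) = value s'' (x i)) ∧
          (∀ i, value s (z i) = value s'' (z i)) ∧ ∀ i, value s' (y i) = value s'' (y i)
  | incl _ x y, _, X => ∀ s ∈ X, ∃ s' ∈ X, ∀ i, value s (x i) = value s' (y i)
  | excl _ x y, _, X => ∀ s ∈ X, ∀ s' ∈ X, ¬ ∀ i, value s (x i) = value s' (y i)
  | and φ ψ, _, X => φ.Sat X ∧ ψ.Sat X
  | or φ ψ, _, X => ∃ Y Z, Y ⊆ X ∧ Z ⊆ X ∧ Y ∪ Z = X ∧ φ.Sat Y ∧ ψ.Sat Z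
  | ex x φ, _, X => ∃ F : X → Set M, (∀ s, (F s).Nonempty) ∧ φ.Sat (supplementTeam X x F)
  | all x φ, _, X => φ.Sat (duplicateTeam X x)

end FOFormula

/-- The logic `FO(C)` with lax team semantics. Dependence logic, independence logic, inclusion logic
and exclusion logic are the cases in which `C` consists of the respective single kind of atoms. -/
noncomputable def FOLogic (L : FirstOrder.Language.{u, u}) (V : Type u) (C : Set DepAtom) :
    TeamLogic L V where
  Form := FOFormula L V C
  fv := FOFormula.fv
  Sat := fun φ _ _ _ _ X => φ.Sat X

end TeamSemantics

/-! Compactness is an ultraproduct argument. An ESO sentence survives ultraproducts: pick witnessing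
relations in each factor, take their ultraproducts, and apply Łoś's theorem in the expanded
vocabulary (`ESOSentence.holdsWith_ultraRel`). Given models `M a`, `X a` of the finite subsets `a`
of `Γ`, take an ultrafilter containing all cones `{a | φ ∈ a}`, and as limit team all classes of
choice functions `s a ∈ X a`. For each finite tuple `v` enumerating the free variables of a formula
in `Γ`, the relation of the limit team is the ultraproduct of the relations of the `X a`, so the
translation of each `φ ∈ Γ` transfers.

For `FO(C)` the translation is an induction on formulas (`FOFormula.isESOIn`). Literals and atoms
are first-order in the relation `X[v]`. Lax disjunctions and quantifiers quantify over relations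
coding the subteams or the extended team; lax semantics makes every such relation come from an
actual split or choice of values. Locality follows, since `X[v]` is unchanged by restriction to the
free variables. -/

namespace TeamSemantics

open Filter

/-! ### Ultraproducts of relations and of existential second-order sentences -/

section Ultraproducts

variable {I : Type u} {M : I → Type u} {U : Ultrafilter I}

/-- The ultraproduct of a family of relations. -/
def ultraRel (U : Ultrafilter I) {n : ℕ} (A : ∀ a, Set (Fin n → M a)) :
    Set (Fin n → (U : Filter I).Product M) :=
  {x | ∃ y : ∀ a, Fin n → M a, (∀ᶠ a in U, y a ∈ A a) ∧
    x = fun i => ((fun a => y a i : ∀ a, M a) : (U : Filter I).Product M)}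

/-- Independence of representatives: a tuple has finitely many coordinates, so two representatives
agree in all of them at once on a large set. -/
theorem cast_mem_ultraRel {n : ℕ} (A : ∀ a, Set (Fin n → M a)) (x : Fin n → ∀ a, M a) :
    (fun i => (x i : (U : Filter I).Product M)) ∈ ultraRel U A ↔
      ∀ᶠ a in U, (fun i => x i a) ∈ A a := by
  constructor
  · rintro ⟨y, hy, hxy⟩
    have h : ∀ i, ∀ᶠ a in U, x i a = y a i := fun i => Quotient.exact (congrFun hxy i)
    filter_upwards [hy, eventually_all.2 h] with a ha h'
    rwa [show (fun i => x i a) = y a from funext h']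
  · exact fun h => ⟨fun a i => x i a, h, rfl⟩

theorem exists_cast_eq {n : ℕ} (x : Fin n → (U : Filter I).Product M) :
    ∃ y : Fin n → ∀ a, M a, x = fun i => (y i : (U : Filter I).Product M) := by
  choose y hy using fun i => Quotient.exists_rep (x i)
  exact ⟨y, funext fun i => (hy i).symm⟩

theorem relMap_cast {L : FirstOrder.Language.{u, u}} [∀ a, L.Structure (M a)] {n : ℕ}
    (R : L.Relations n) (x : Fin n → ∀ a, M a) :
    (FirstOrder.Language.Structure.RelMap R fun i => (x i : (U : Filter I).Product M)) ↔
      ∀ᶠ a in U, FirstOrder.Language.Structure.RelMap R fun i => x i a :=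
  FirstOrder.Language.relMap_quotient_mk' (L := L) (s := (U : Filter I).productSetoid M) R x

/-- Existential second-order sentences are preserved under ultraproducts. -/
theorem ESOSentence.holdsWith_ultraRel {L : FirstOrder.Language.{u, u}} [∀ a, L.Structure (M a)]
    [∀ a, Nonempty (M a)] {n : ℕ} (χ : ESOSentence (withRel L n)) (A : ∀ a, Set (Fin n → M a))
    (h : ∀ᶠ a in U, χ.HoldsWith (M a) (A a)) :
    χ.HoldsWith ((U : Filter I).Product M) (ultraRel U A) := by
  classical
  -- Witnesses are needed at every index; where the sentence fails, empty relations serve as a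
  -- default.
  have h₁ : ∀ a, ∃ S : ∀ i, Set (Fin (χ.arity i) → M a), χ.HoldsWith (M a) (A a) →
      letI : (relLang (fun _ : Unit => n)).Structure (M a) := relStructure _ (fun _ => A a)
      letI : (relLang χ.arity).Structure (M a) := relStructure χ.arity S
      M a ⊨ χ.matrix := by
    intro a
    by_cases ha : χ.HoldsWith (M a) (A a)
    · exact ha.imp fun S hS _ => hS
    · exact ⟨fun _ => ∅, fun h => (ha h).elim⟩
  choose S hS using h₁
  refine ⟨fun i => ultraRel U fun a => S a i, ?_⟩
  let _ (a : I) : (relLang (fun _ : Unit => n)).Structure (M a) := relStructure _ (fun _ => A a)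
  let _ (a : I) : (relLang χ.arity).Structure (M a) := relStructure χ.arity (S a)
  have h₂ := (FirstOrder.Language.Ultraproduct.sentence_realize (u := U) (M := M) χ.matrix).2
    (h.mono fun a ha => hS a ha)
  -- Łoś's theorem speaks of the ultraproduct of the expanded structures; it remains to see, symbol
  -- by symbol, that this is the ultraproduct expanded by the relations `ultraRel`.
  convert! h₂ using 1
  refine FirstOrder.Language.Structure.ext ?_ ?_
  · funext k f x
    obtain ⟨x, rfl⟩ := exists_cast_eq x
    refine Eq.trans ?_ (FirstOrder.Language.Ultraproduct.funMap_cast f x).symm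
    rcases f with (f | f) | f
    · exact FirstOrder.Language.Ultraproduct.funMap_cast f x
    · exact f.elim
    · exact f.elim
  · funext k R x
    obtain ⟨x, rfl⟩ := exists_cast_eq x
    refine propext (Iff.trans ?_ (relMap_cast R x).symm)
    rcases R with (R | ⟨i, rfl⟩) | ⟨i, rfl⟩
    · exact relMap_cast R x
    · exact cast_mem_ultraRel A x
    · exact cast_mem_ultraRel (fun a => S a i) x

end Ultraproducts

/-! ### Compactness and locality from the translation -/

namespace TeamLogic

variable {L : FirstOrder.Language.{u, u}} {V : Type u} {𝓛 : TeamLogic L V}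

theorem exists_enumeration_fv (φ : 𝓛.Form) :
    ∃ (n : ℕ) (v : Fin n → V), Function.Injective v ∧ Set.range v = (𝓛.fv φ : Set V) := by
  refine ⟨_, fun i => ((𝓛.fv φ).equivFin.symm i : V),
    Subtype.val_injective.comp (Equiv.injective _), ?_⟩
  rw [Set.range_comp' Subtype.val, (Equiv.surjective _).range_eq, Set.image_univ]
  simp

/-- Compactness for logics that admit a translation into existential second-order logic. -/
theorem TranslatesToESO.compactness (hT : 𝓛.TranslatesToESO) {Γ : Set 𝓛.Form}
    (hΓ : 𝓛.FinitelySatisfiable Γ) : 𝓛.Satisfiable Γ := by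
  classical
  have h : ∀ a : Finset Γ, 𝓛.Satisfiable (Subtype.val '' (a : Set Γ)) := fun a =>
    hΓ _ (by rintro _ ⟨φ, -, rfl⟩; exact φ.2) (a.finite_toSet.image _)
  choose M hM hne D X hX hsat using h
  let U : Ultrafilter (Finset Γ) := Ultrafilter.of atTop
  have hU : ∀ φ : Γ, ∀ᶠ a in (U : Filter (Finset Γ)), φ ∈ a := fun φ =>
    Ultrafilter.of_le _ ((eventually_ge_atTop {φ}).mono fun _ ha =>
      Finset.singleton_subset_iff.1 ha)
  -- `D a` need not contain `D'`, so `lim` uses `value` with its default. This is harmless: a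
  -- variable of `φ` lies in `D a` for all `a` containing `φ`, hence for almost all `a`.
  let D' : Set V := {x | ∃ φ ∈ Γ, x ∈ 𝓛.fv φ}
  let lim (s : ∀ a, D a → M a) : D' → (U : Filter (Finset Γ)).Product M :=
    fun x => ((fun a => value (s a) x : ∀ a, M a) : (U : Filter (Finset Γ)).Product M)
  refine ⟨(U : Filter (Finset Γ)).Product M, inferInstance, inferInstance, D',
    {t | ∃ s : ∀ a, D a → M a, (∀ a, s a ∈ X a) ∧ t = lim s},
    ⟨_, fun a => (hX a).some, fun a => (hX a).some_mem, rfl⟩, fun φ hφ => ?_⟩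
  have hD : (𝓛.fv φ : Set V) ⊆ D' := fun x hx => ⟨φ, hφ, hx⟩
  refine ⟨hD, ?_⟩
  obtain ⟨n, v, hv, hrange⟩ := exists_enumeration_fv φ
  obtain ⟨χ, hχ⟩ := hT φ n v hv hrange
  have hmem (i) : v i ∈ 𝓛.fv φ := by
    rw [← Finset.mem_coe, ← hrange]; exact Set.mem_range_self i
  rw [hχ _ D' (fun i => hD (hmem i))]
  let A (a : Finset Γ) : Set (Fin n → M a) := (fun s i => value s (v i)) '' X a
  convert χ.holdsWith_ultraRel (U := U) A ?_ using 1
  · ext x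
    constructor
    · rintro ⟨_, ⟨s, hs, rfl⟩, rfl⟩
      exact ⟨fun a i => value (s a) (v i), .of_forall fun a => ⟨s a, hs a, rfl⟩, rfl⟩
    · rintro ⟨y, hy, rfl⟩
      -- `y a` comes from `X a` only for almost all `a`; elsewhere any member of `X a` will do,
      -- which is where nonemptiness of the teams enters.
      have : ∀ a, ∃ s ∈ X a, y a ∈ A a → (fun i => value s (v i)) = y a := by
        intro a
        by_cases ha : y a ∈ A a
        · obtain ⟨s, hs, h⟩ := ha
          exact ⟨s, hs, fun _ => h⟩
        · exact ⟨(hX a).some, (hX a).some_mem, fun h => (ha h).elim⟩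
      choose s hs hsy using this
      refine ⟨lim s, ⟨s, hs, rfl⟩, funext fun i => Quotient.sound ?_⟩
      exact hy.mono fun a ha => congrFun (hsy a ha) i
  · filter_upwards [hU ⟨φ, hφ⟩] with a ha
    obtain ⟨h₁, h₂⟩ := hsat a φ ⟨_, ha, rfl⟩
    have := (hχ _ (D a) (fun i => h₁ (hmem i)) (X a)).1 h₂
    convert this using 1
    refine congrArg (· '' X a) (funext fun s => funext fun i => ?_)
    exact dif_pos (h₁ (hmem i))

/-- A translation into existential second-order logic depends only on the values of the free
variables. -/
theorem TranslatesToESO.isLocal (hT : 𝓛.TranslatesToESO) : 𝓛.IsLocal := by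
  intro φ M _ _ D h X
  obtain ⟨n, v, hv, hrange⟩ := exists_enumeration_fv φ
  obtain ⟨χ, hχ⟩ := hT φ n v hv hrange
  have hmem (i) : v i ∈ (𝓛.fv φ : Set V) := hrange ▸ Set.mem_range_self i
  rw [hχ M D (fun i => h (hmem i)) X, hχ M _ hmem]
  simp only [teamRel, restrictTeam, Set.image_image]
  rfl

end TeamLogic

/-! ### Closure properties of ESO-definable properties of relations -/

section ESODefinability

open FirstOrder.Language

variable {L : FirstOrder.Language.{u, u}} {ι κ : Type} {M : Type u}

/-- Truth of a sentence in the structure `M` expanded by the relations `S`. -/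
def SatWith [L.Structure M] {ar : ι → ℕ} (α : (L.sum (relLang ar)).Sentence)
    (S : ∀ i, Set (Fin (ar i) → M)) : Prop :=
  letI : (relLang ar).Structure M := relStructure ar S
  M ⊨ α

/-- The map of vocabularies induced by an arity preserving map of relation symbols. -/
def relLangMap {ar : ι → ℕ} {ar' : κ → ℕ} (e : ι → κ) (h : ∀ i, ar' (e i) = ar i) :
    relLang ar →ᴸ relLang ar' where
  onFunction := fun _ f => f.elim
  onRelation := fun _ r => ⟨e r.1, (h r.1).trans r.2⟩

/-- The sentence obtained by renaming relation symbols. -/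
def renameRel {ar : ι → ℕ} {ar' : κ → ℕ} (e : ι → κ) (h : ∀ i, ar' (e i) = ar i)
    (α : (L.sum (relLang ar)).Sentence) : (L.sum (relLang ar')).Sentence :=
  (LHom.sumMap (LHom.id L) (relLangMap e h)).onSentence α

theorem satWith_renameRel [L.Structure M] {ar : ι → ℕ} {ar' : κ → ℕ} (e : ι → κ)
    (h : ∀ i, ar' (e i) = ar i) (α : (L.sum (relLang ar)).Sentence)
    (S : ∀ i, Set (Fin (ar' i) → M)) (T : ∀ i, Set (Fin (ar i) → M))
    (hT : ∀ i x, x ∈ T i ↔ (fun j => x (Fin.cast (h i) j)) ∈ S (e i)) :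
    SatWith (renameRel e h α) S ↔ SatWith α T := by
  let _ : (relLang ar).Structure M := relStructure ar T
  let _ : (relLang ar').Structure M := relStructure ar' S
  have : (relLangMap e h).IsExpansionOn M := by
    refine ⟨fun f => f.elim, fun {n} R x => ?_⟩
    obtain ⟨i, rfl⟩ := R
    exact propext (hT i _).symm
  exact LHom.realize_onSentence M _ α

theorem satWith_inf [L.Structure M] {ar : ι → ℕ} (α β : (L.sum (relLang ar)).Sentence)
    (S : ∀ i, Set (Fin (ar i) → M)) :
    SatWith (α ⊓ β : (L.sum (relLang ar)).Sentence) S ↔ SatWith α S ∧ SatWith β S :=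
  let _ : (relLang ar).Structure M := relStructure ar S
  Formula.realize_inf

/-- The union of two families of relations. -/
def joinRel {ar : ι → ℕ} {ar' : κ → ℕ} (S : ∀ i, Set (Fin (ar i) → M))
    (T : ∀ i, Set (Fin (ar' i) → M)) : ∀ i, Set (Fin (Sum.elim ar ar' i) → M)
  | .inl i => S i
  | .inr i => T i

variable (L) in
/-- Properties of families of relations that are definable by a first-order sentence. -/
def IsFO (ar : ι → ℕ) (P : ∀ (M : Type u) [L.Structure M] [Nonempty M],
    (∀ i, Set (Fin (ar i) → M)) → Prop) : Prop :=
  ∃ α : (L.sum (relLang ar)).Sentence, ∀ (M : Type u) [L.Structure M] [Nonempty M]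
    (S : ∀ i, Set (Fin (ar i) → M)), P M S ↔ SatWith α S

variable (L) in
/-- Properties of families of relations that are definable by an existential second-order
sentence. -/
def IsESO (ar : ι → ℕ) (P : ∀ (M : Type u) [L.Structure M] [Nonempty M],
    (∀ i, Set (Fin (ar i) → M)) → Prop) : Prop :=
  ∃ (κ : Type) (_ : Finite κ) (ar' : κ → ℕ) (α : (L.sum (relLang (Sum.elim ar ar'))).Sentence),
    ∀ (M : Type u) [L.Structure M] [Nonempty M] (S : ∀ i, Set (Fin (ar i) → M)),
      P M S ↔ ∃ T : ∀ i, Set (Fin (ar' i) → M), SatWith α (joinRel S T)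

variable {ar : ι → ℕ} {P Q : ∀ (M : Type u) [L.Structure M] [Nonempty M],
    (∀ i, Set (Fin (ar i) → M)) → Prop}

theorem IsFO.isESO (h : IsFO L ar P) : IsESO L ar P := by
  obtain ⟨α, hα⟩ := h
  refine ⟨Empty, inferInstance, Empty.elim, renameRel Sum.inl (fun _ => rfl) α,
    fun M _ _ S => ?_⟩
  have e (T) := satWith_renameRel Sum.inl (fun _ => rfl) α (joinRel (ar' := Empty.elim) S T) S
    fun i x => Iff.rfl
  simp only [e, hα]
  exact ⟨fun h => ⟨nofun, h⟩, fun ⟨_, h⟩ => h⟩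

/-- The quantified relations of the two sentences are kept apart by indexing them with a disjoint
union; this is why arbitrary finite index types are allowed in `IsESO`. -/
theorem IsESO.and (hP : IsESO L ar P) (hQ : IsESO L ar Q) :
    IsESO L ar fun M _ _ S => P M S ∧ Q M S := by
  obtain ⟨κ₁, _, ar₁, α, hα⟩ := hP
  obtain ⟨κ₂, _, ar₂, β, hβ⟩ := hQ
  have h₁ : ∀ i, Sum.elim ar (Sum.elim ar₁ ar₂) (Sum.map id Sum.inl i) = Sum.elim ar ar₁ i := by
    rintro (i | i) <;> rfl
  have h₂ : ∀ i, Sum.elim ar (Sum.elim ar₁ ar₂) (Sum.map id Sum.inr i) = Sum.elim ar ar₂ i := by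
    rintro (i | i) <;> rfl
  refine ⟨κ₁ ⊕ κ₂, inferInstance, Sum.elim ar₁ ar₂, renameRel _ h₁ α ⊓ renameRel _ h₂ β,
    fun M _ _ S => ?_⟩
  have e₁ (T : ∀ i, Set (Fin (Sum.elim ar₁ ar₂ i) → M)) :=
    satWith_renameRel _ h₁ α (joinRel S T) (joinRel S fun i => T (.inl i))
      (by rintro (i | i) x <;> rfl)
  have e₂ (T : ∀ i, Set (Fin (Sum.elim ar₁ ar₂ i) → M)) :=
    satWith_renameRel _ h₂ β (joinRel S T) (joinRel S fun i => T (.inr i))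
      (by rintro (i | i) x <;> rfl)
  simp only [satWith_inf, e₁, e₂, hα, hβ]
  constructor
  · rintro ⟨⟨T₁, h₁⟩, T₂, h₂⟩
    exact ⟨joinRel T₁ T₂, h₁, h₂⟩
  · rintro ⟨T, h₁, h₂⟩
    exact ⟨⟨_, h₁⟩, _, h₂⟩

/-- Lets a property of one relation be asserted of a chosen member of a larger family, as needed for
the induction hypotheses below. -/
theorem IsESO.comap {ar' : κ → ℕ} (e : ι → κ) (h : ∀ i, ar' (e i) = ar i) (hP : IsESO L ar P) :
    IsESO L ar' fun M _ _ S => P M fun i => {x | (fun j => x (Fin.cast (h i) j)) ∈ S (e i)} := by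
  obtain ⟨κ₁, _, ar₁, α, hα⟩ := hP
  have h₁ : ∀ i, Sum.elim ar' ar₁ (Sum.map e id i) = Sum.elim ar ar₁ i := by
    rintro (i | i)
    · exact h i
    · rfl
  refine ⟨κ₁, inferInstance, ar₁, renameRel _ h₁ α, fun M _ _ S => ?_⟩
  refine (hα M _).trans ?_
  refine exists_congr fun T => (satWith_renameRel _ h₁ α _ _ ?_).symm
  rintro (i | i) x <;> rfl

theorem IsESO.exists [Finite κ] {ar' : κ → ℕ} {P : ∀ (M : Type u) [L.Structure M] [Nonempty M],
    (∀ i, Set (Fin (Sum.elim ar ar' i) → M)) → Prop} (hP : IsESO L (Sum.elim ar ar') P) :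
    IsESO L ar fun M _ _ S => ∃ T : ∀ i, Set (Fin (ar' i) → M), P M (joinRel S T) := by
  obtain ⟨κ₁, _, ar₁, α, hα⟩ := hP
  have h : ∀ i, Sum.elim ar (Sum.elim ar' ar₁) (Equiv.sumAssoc _ _ _ i) =
      Sum.elim (Sum.elim ar ar') ar₁ i := by
    rintro ((i | i) | i) <;> rfl
  refine ⟨κ ⊕ κ₁, inferInstance, Sum.elim ar' ar₁, renameRel _ h α, fun M _ _ S => ?_⟩
  have e (T : ∀ i, Set (Fin (Sum.elim ar' ar₁ i) → M)) :=
    satWith_renameRel _ h α (joinRel S T)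
      (joinRel (joinRel S fun i => T (.inl i)) fun i => T (.inr i))
      (by rintro ((i | i) | i) x <;> rfl)
  simp only [e, hα]
  constructor
  · rintro ⟨T₁, T₂, h⟩
    exact ⟨joinRel T₁ T₂, h⟩
  · rintro ⟨T, h⟩
    exact ⟨_, _, h⟩

/-- The passage from a vocabulary with two families of fresh relation symbols to one in which the
families are added one after the other. -/
def splitRel {ar' : κ → ℕ} :
    L.sum (relLang (Sum.elim ar ar')) →ᴸ (L.sum (relLang ar)).sum (relLang ar') where
  onFunction := fun _ f => f.elim (fun f => .inl (.inl f)) Empty.elim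
  onRelation := fun _ r => r.elim (fun r => .inl (.inl r)) fun
    | ⟨.inl i, h⟩ => .inl (.inr ⟨i, h⟩)
    | ⟨.inr i, h⟩ => .inr ⟨i, h⟩

/-- Returns to the official syntax: the index type is numbered by some `Fin k`, and `splitRel`
separates the symbol `R` from the quantified ones. -/
theorem IsESO.exists_sentence {n : ℕ} {P : ∀ (M : Type u) [L.Structure M] [Nonempty M],
    (Unit → Set (Fin n → M)) → Prop} (hP : IsESO L (fun _ : Unit => n) P) :
    ∃ χ : ESOSentence (withRel L n), ∀ (M : Type u) [L.Structure M] [Nonempty M]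
      (A : Set (Fin n → M)), P M (fun _ => A) ↔ χ.HoldsWith M A := by
  obtain ⟨κ, _, ar', α, hα⟩ := hP
  obtain ⟨k, ⟨e⟩⟩ := Finite.exists_equiv_fin κ
  have h : ∀ i, Sum.elim (fun _ : Unit => n) (ar' ∘ e.symm) (Sum.map id e i) =
      Sum.elim (fun _ : Unit => n) ar' i := by
    rintro (i | i)
    · rfl
    · exact congrArg ar' (e.symm_apply_apply i)
  refine ⟨⟨k, ar' ∘ e.symm, splitRel.onSentence (renameRel _ h α)⟩, fun M _ _ A => ?_⟩
  have key (T : ∀ i, Set (Fin (ar' (e.symm i)) → M)) :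
      (letI : (relLang (fun _ : Unit => n)).Structure M := relStructure _ (fun _ => A)
       letI : (relLang (ar' ∘ e.symm)).Structure M := relStructure _ T
       M ⊨ splitRel.onSentence (renameRel _ h α)) ↔
      SatWith (renameRel _ h α) (joinRel (ar' := ar' ∘ e.symm) (fun _ => A) T) := by
    let _ : (relLang (fun _ : Unit => n)).Structure M := relStructure _ (fun _ => A)
    let _ : (relLang (ar' ∘ e.symm)).Structure M := relStructure _ T
    let _ : (relLang (Sum.elim (fun _ : Unit => n) (ar' ∘ e.symm))).Structure M :=
      relStructure _ (joinRel (fun _ => A) T)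
    have : (splitRel (L := L) (ar := fun _ : Unit => n)
        (ar' := ar' ∘ e.symm)).IsExpansionOn M := by
      constructor
      · rintro m (f | f) x
        · rfl
        · exact f.elim
      · rintro m (r | ⟨i | i, rfl⟩) x <;> rfl
    exact LHom.realize_onSentence M _ _
  rw [hα]
  constructor
  · rintro ⟨T, hT⟩
    refine ⟨fun i => T (e.symm i), (key _).2 ((satWith_renameRel _ h α _ _ ?_).2 hT)⟩
    rintro (i | i) x
    · rfl
    · change x ∈ T i ↔ (fun j => x (Fin.cast (congrArg ar' (e.symm_apply_apply i)) j)) ∈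
        T (e.symm (e i))
      -- The index `e.symm (e i)` equals `i` only propositionally; generalizing it allows
      -- substitution, after which the cast is trivial.
      have aux : ∀ (i' : κ) (_ : i' = i) (pf : ar' i' = ar' i),
          x ∈ T i ↔ (fun j => x (Fin.cast pf j)) ∈ T i' := by
        rintro _ rfl _; rfl
      exact aux _ (e.symm_apply_apply i) _
  · rintro ⟨T, hT⟩
    exact ⟨_, (satWith_renameRel _ h α _
      (joinRel (ar := fun _ : Unit => n) (fun _ => A) fun i =>
        {x | (fun j => x (Fin.cast (congrArg ar' (e.symm_apply_apply i)) j)) ∈ T (e i)})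
      (by rintro (i | i) x <;> rfl)).1 ((key T).1 hT)⟩

end ESODefinability

/-! ### First-order definability of the atoms and of the team operations -/

section FODefinability

open FirstOrder.Language

variable {L : FirstOrder.Language.{u, u}} {ι : Type} {ar : ι → ℕ} {n : ℕ}

/-- The atomic formula stating that the tuple of variables `t` belongs to the `i`-th relation. -/
def relAtom {β : Type} (i : ι) (t : Fin (ar i) → β) : (L.sum (relLang ar)).Formula β :=
  Relations.formula (L := L.sum (relLang ar)) (Sum.inr ⟨i, rfl⟩) fun j => .var (t j)

/-- Supplies the meaning of `relAtom` as a hypothesis, so that `simp` can evaluate an explicit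
defining sentence. -/
theorem IsFO.of_formula {P : ∀ (M : Type u) [L.Structure M] [Nonempty M],
    (∀ i, Set (Fin (ar i) → M)) → Prop} (α : (L.sum (relLang ar)).Sentence)
    (h : ∀ (M : Type u) [L.Structure M] [Nonempty M] (S : ∀ i, Set (Fin (ar i) → M)),
      letI : (relLang ar).Structure M := relStructure ar S
      (∀ (β : Type) (i : ι) (t : Fin (ar i) → β) (s : β → M),
        (relAtom (L := L) i t).Realize s ↔ (fun j => s (t j)) ∈ S i) →
      (P M S ↔ Formula.Realize α (default : Empty → M))) : IsFO L ar P :=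
  ⟨α, fun M _ _ S =>
    let _ : (relLang ar).Structure M := relStructure ar S
    h M S fun _ _ _ _ => Formula.realize_rel⟩

/-- The atomic formula stating that the tuple of variables `t` belongs to the first relation. -/
def relAtomLeft {κ : Type} {m : ℕ} {β : Type} (t : Fin n → β) :
    (L.sum (relLang (Sum.elim (fun _ : Unit => n) fun _ : κ => m))).Formula β :=
  relAtom (ι := Unit ⊕ κ) (.inl ()) t

/-- The atomic formula stating that the tuple of variables `t` belongs to the `k`-th relation of the
second family. -/
def relAtomRight {κ : Type} {m : ℕ} {β : Type} (k : κ) (t : Fin m → β) :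
    (L.sum (relLang (Sum.elim (fun _ : Unit => n) fun _ : κ => m))).Formula β :=
  relAtom (ι := Unit ⊕ κ) (.inr k) t

theorem IsFO.of_formula₂ {κ : Type} {m : ℕ} {P : ∀ (M : Type u) [L.Structure M] [Nonempty M],
    Set (Fin n → M) → (κ → Set (Fin m → M)) → Prop}
    (α : (L.sum (relLang (Sum.elim (fun _ : Unit => n) fun _ : κ => m))).Sentence)
    (h : ∀ (M : Type u) [L.Structure M] [Nonempty M] (A : Set (Fin n → M))
      (B : κ → Set (Fin m → M)),
      letI : (relLang (Sum.elim (fun _ : Unit => n) fun _ : κ => m)).Structure M :=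
        relStructure _ (joinRel (fun _ => A) B)
      (∀ (β : Type) (t : Fin n → β) (s : β → M),
        (relAtomLeft (L := L) (κ := κ) (m := m) t).Realize s ↔ (fun j => s (t j)) ∈ A) →
      (∀ (β : Type) (k : κ) (t : Fin m → β) (s : β → M),
        (relAtomRight (L := L) (n := n) k t).Realize s ↔ (fun j => s (t j)) ∈ B k) →
      (P M A B ↔ Formula.Realize α (default : Empty → M))) :
    IsFO L (Sum.elim (fun _ : Unit => n) fun _ : κ => m)
      fun M _ _ S => P M (S (.inl ())) fun k => S (.inr k) := by
  refine .of_formula α fun M _ _ S hS => ?_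
  obtain ⟨A, B, rfl⟩ : ∃ (A : Set (Fin n → M)) (B : κ → Set (Fin m → M)),
      S = joinRel (ar := fun _ : Unit => n) (ar' := fun _ : κ => m) (fun _ => A) B :=
    ⟨S (.inl ()), fun k => S (.inr k), by funext i; rcases i with i | i <;> rfl⟩
  exact h M A B (fun β t s => hS β (.inl ()) t s) fun β k t s => hS β (.inr k) t s

/-- A term in the variables `x₀, …, xₙ₋₁`, in the expanded vocabulary and with the variables
renamed. -/
def expandTerm {β : Type} (f : Fin n → β) (t : L.Term (Fin n)) : (L.sum (relLang ar)).Term β :=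
  (LHom.sumInl.onTerm t).relabel f

theorem realize_expandTerm {M : Type u} [L.Structure M] [(relLang ar).Structure M] {β : Type}
    (f : Fin n → β) (t : L.Term (Fin n)) (s : β → M) :
    (expandTerm (ar := ar) f t).realize s = t.realize fun j => s (f j) := by
  simp [expandTerm, Function.comp_def]

theorem isFO_eq (t t' : L.Term (Fin n)) : IsFO L (fun _ : Unit => n) fun _ _ _ S =>
    ∀ r ∈ S (), t.realize r = t'.realize r := by
  refine .of_formula (((relAtom () Sum.inr).imp
    ((expandTerm Sum.inr t).equal (expandTerm Sum.inr t'))).iAlls (Fin n)) fun M _ _ S h => ?_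
  simp [h, realize_expandTerm]

theorem isFO_neq (t t' : L.Term (Fin n)) : IsFO L (fun _ : Unit => n) fun _ _ _ S =>
    ∀ r ∈ S (), t.realize r ≠ t'.realize r := by
  refine .of_formula (((relAtom () Sum.inr).imp
    ((expandTerm Sum.inr t).equal (expandTerm Sum.inr t')).not).iAlls (Fin n)) fun M _ _ S h => ?_
  simp [h, realize_expandTerm]

/-- An atomic formula in the expanded vocabulary, for a relation symbol of the original one. -/
def expandAtom {β : Type} {k : ℕ} (f : Fin n → β) (R : L.Relations k) (t : Fin k → L.Term (Fin n)) :
    (L.sum (relLang ar)).Formula β :=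
  Relations.formula (L := L.sum (relLang ar)) (Sum.inl R) fun i => expandTerm f (t i)

theorem realize_expandAtom {M : Type u} [L.Structure M] [(relLang ar).Structure M] {β : Type}
    {k : ℕ} (f : Fin n → β) (R : L.Relations k) (t : Fin k → L.Term (Fin n)) (s : β → M) :
    (expandAtom (ar := ar) f R t).Realize s ↔
      Structure.RelMap R fun i => (t i).realize fun j => s (f j) := by
  refine Formula.realize_rel.trans ?_
  simp only [realize_expandTerm]
  rfl

theorem isFO_rel {k : ℕ} (R : L.Relations k) (t : Fin k → L.Term (Fin n)) :
    IsFO L (fun _ : Unit => n) fun _ _ _ S =>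
      ∀ r ∈ S (), Structure.RelMap R fun i => (t i).realize r := by
  refine .of_formula (((relAtom () Sum.inr).imp (expandAtom Sum.inr R t)).iAlls (Fin n)) fun M _ _ S h => ?_
  simp [h, realize_expandAtom]

theorem isFO_nrel {k : ℕ} (R : L.Relations k) (t : Fin k → L.Term (Fin n)) :
    IsFO L (fun _ : Unit => n) fun _ _ _ S =>
      ∀ r ∈ S (), ¬ Structure.RelMap R fun i => (t i).realize r := by
  refine .of_formula (((relAtom () Sum.inr).imp (expandAtom Sum.inr R t).not).iAlls (Fin n)) fun M _ _ S h => ?_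
  simp [h, realize_expandAtom]

/-- The formula stating that two tuples of variables have the same values. -/
noncomputable def tupleEq {L : FirstOrder.Language.{u, u}} {β : Type} {k : ℕ} (f g : Fin k → β) :
    L.Formula β :=
  Formula.iInf fun i => (Term.var (f i)).equal (Term.var (g i))

theorem realize_tupleEq {M : Type u} [L.Structure M] {β : Type} {k : ℕ} (f g : Fin k → β)
    (s : β → M) : (tupleEq (L := L) f g).Realize s ↔ ∀ i, s (f i) = s (g i) := by
  simp [tupleEq]

theorem isFO_dep {k : ℕ} (x : Fin k → Fin n) (y : Fin n) :
    IsFO L (fun _ : Unit => n) fun _ _ _ S =>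
      ∀ r ∈ S (), ∀ r' ∈ S (), (∀ i, r (x i) = r' (x i)) → r y = r' y := by
  refine .of_formula (((relAtom () Sum.inr).imp (((relAtom () Sum.inr).imp
    ((tupleEq (fun i => .inl (.inr (x i))) fun i => .inr (x i)).imp
      ((Term.var (.inl (.inr y))).equal (Term.var (.inr y))))).iAlls (Fin n))).iAlls (Fin n))
    fun M _ _ S h => ?_
  simp [h, realize_tupleEq]

theorem isFO_indep {k l m : ℕ} (x : Fin k → Fin n) (z : Fin l → Fin n) (y : Fin m → Fin n) :
    IsFO L (fun _ : Unit => n) fun _ _ _ S =>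
      ∀ r ∈ S (), ∀ r' ∈ S (), (∀ i, r (z i) = r' (z i)) →
        ∃ r'' ∈ S (), (∀ i, r (x i) = r'' (x i)) ∧ (∀ i, r (z i) = r'' (z i)) ∧
          ∀ i, r' (y i) = r'' (y i) := by
  -- Each block of quantifiers adds a summand on the right: under all three, `.inl (.inl (.inr _))`,
  -- `.inl (.inr _)` and `.inr _` are the entries of `r`, `r'` and `r''`.
  refine .of_formula (((relAtom () Sum.inr).imp (((relAtom () Sum.inr).imp
    ((tupleEq (fun i => .inl (.inr (z i))) fun i => .inr (z i)).imp
      ((relAtom () Sum.inr ⊓ (tupleEq (fun i => .inl (.inl (.inr (x i)))) (fun i => .inr (x i)) ⊓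
        (tupleEq (fun i => .inl (.inl (.inr (z i)))) (fun i => .inr (z i)) ⊓
          tupleEq (fun i => .inl (.inr (y i))) fun i => .inr (y i))) :
        (L.sum (relLang _)).Formula _).iExs (Fin n)))).iAlls (Fin n))).iAlls (Fin n))
    fun M _ _ S h => ?_
  simp [h, realize_tupleEq]

theorem isFO_incl {k : ℕ} (x y : Fin k → Fin n) :
    IsFO L (fun _ : Unit => n) fun _ _ _ S =>
      ∀ r ∈ S (), ∃ r' ∈ S (), ∀ i, r (x i) = r' (y i) := by
  refine .of_formula (((relAtom () Sum.inr).imp ((relAtom () Sum.inr ⊓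
    tupleEq (fun i => .inl (.inr (x i))) fun i => .inr (y i) :
      (L.sum (relLang _)).Formula _).iExs (Fin n))).iAlls (Fin n)) fun M _ _ S h => ?_
  simp [h, realize_tupleEq]

theorem isFO_excl {k : ℕ} (x y : Fin k → Fin n) :
    IsFO L (fun _ : Unit => n) fun _ _ _ S =>
      ∀ r ∈ S (), ∀ r' ∈ S (), ¬ ∀ i, r (x i) = r' (y i) := by
  refine .of_formula (((relAtom () Sum.inr).imp (((relAtom () Sum.inr).imp
    (tupleEq (fun i => .inl (.inr (x i))) fun i => .inr (y i)).not).iAlls (Fin n))).iAlls (Fin n))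
    fun M _ _ S h => ?_
  simp [h, realize_tupleEq]

theorem isFO_union :
    IsFO L (Sum.elim (fun _ : Unit => n) fun _ : Bool => n) fun _ _ _ S =>
      S (.inr false) ∪ S (.inr true) = S (.inl ()) := by
  refine .of_formula₂ (P := fun _ _ _ A B => B false ∪ B true = A)
    (((relAtomRight false Sum.inr ⊔
    relAtomRight true Sum.inr : (L.sum (relLang _)).Formula _).iff
      (relAtomLeft Sum.inr)).iAlls (Fin n)) fun M _ _ A B hA hB => ?_
  simp [hA, hB, Set.ext_iff]

/-- Here and in the next two lemmas `e` prescribes, for each entry of the longer tuple, whether it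
is copied from `r` or is the new value `a`. -/
theorem isFO_forall_extension {m : ℕ} (e : Fin m → Fin n ⊕ Unit) :
    IsFO L (Sum.elim (fun _ : Unit => n) fun _ : Unit => m) fun M _ _ S =>
      ∀ r ∈ S (.inl ()), ∀ a : Unit → M, (fun j => Sum.elim r a (e j)) ∈ S (.inr ()) := by
  refine .of_formula₂ (P := fun M _ _ A B =>
    ∀ r ∈ A, ∀ a : Unit → M, (fun j => Sum.elim r a (e j)) ∈ B ())
    (((relAtomLeft Sum.inr).imp
    ((relAtomRight () fun j => (e j).map Sum.inr id).iAlls Unit)).iAlls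
      (Fin n)) fun M _ _ A B hA hB => ?_
  simp [hA, hB, Sum.elim_map]

theorem isFO_exists_extension {m : ℕ} (e : Fin m → Fin n ⊕ Unit) :
    IsFO L (Sum.elim (fun _ : Unit => n) fun _ : Unit => m) fun M _ _ S =>
      ∀ r ∈ S (.inl ()), ∃ a : Unit → M, (fun j => Sum.elim r a (e j)) ∈ S (.inr ()) := by
  refine .of_formula₂ (P := fun M _ _ A B =>
    ∀ r ∈ A, ∃ a : Unit → M, (fun j => Sum.elim r a (e j)) ∈ B ())
    (((relAtomLeft Sum.inr).imp
    ((relAtomRight () fun j => (e j).map Sum.inr id).iExs Unit)).iAlls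
      (Fin n)) fun M _ _ A B hA hB => ?_
  simp [hA, hB, Sum.elim_map]

theorem isFO_isExtension {m : ℕ} (e : Fin m → Fin n ⊕ Unit) :
    IsFO L (Sum.elim (fun _ : Unit => n) fun _ : Unit => m) fun M _ _ S =>
      ∀ q ∈ S (.inr ()), ∃ r ∈ S (.inl ()), ∃ a : Unit → M, q = fun j => Sum.elim r a (e j) := by
  refine .of_formula₂ (P := fun M _ _ A B =>
    ∀ q ∈ B (), ∃ r ∈ A, ∃ a : Unit → M, q = fun j => Sum.elim r a (e j))
    (((relAtomRight () Sum.inr).imp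
    ((relAtomLeft Sum.inr ⊓
      (tupleEq (fun j => .inl (.inl (.inr j))) fun j => (e j).map Sum.inr id).iExs Unit :
        (L.sum (relLang _)).Formula _).iExs (Fin n))).iAlls (Fin m)) fun M _ _ A B hA hB => ?_
  simp [hA, hB, Sum.elim_map, realize_tupleEq, funext_iff]

end FODefinability
-- Translation of `FO(C)` into existential second-order logic
section Translation

open FirstOrder.Language

variable {L : FirstOrder.Language.{u, u}} {V M : Type u} {n : ℕ}

/-- The relation `{(s v₀, …, s vₙ₋₁) | s ∈ X}`, for arbitrary variables `v₀, …, vₙ₋₁`. -/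
def valueRel [Nonempty M] {D : Set V} (X : Set (D → M)) (v : Fin n → V) : Set (Fin n → M) :=
  (fun s j => value s (v j)) '' X

theorem valueRel_eq_teamRel [Nonempty M] {D : Set V} (X : Set (D → M)) (v : Fin n → V)
    (h : ∀ i, v i ∈ D) : valueRel X v = teamRel X v h :=
  congrArg (· '' X) (funext fun _ => funext fun i => dif_pos (h i))

theorem value_updateAssignment [Nonempty M] [DecidableEq V] {D : Set V} (s : D → M) (x : V) (a : M)
    (y : V) : value (updateAssignment s x a) y = if y = x then a else value s y := by
  by_cases hy : y = x
  · subst hy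
    simp [value, updateAssignment]
  · by_cases hD : y ∈ D <;> simp [value, updateAssignment, hy, hD]

open Classical in
/-- The values of `x, v₀, …, vₙ₋₁` under `s(a/x)` in terms of those of `v₀, …, vₙ₋₁` under `s`
and of `a`. -/
noncomputable def updateIndex (x : V) (v : Fin n → V) : Fin (n + 1) → Fin n ⊕ Unit :=
  Fin.cons (.inr ()) fun j => if v j = x then .inr () else .inl j

theorem value_updateAssignment_cons [Nonempty M] {D : Set V} (s : D → M) (x : V) (a : M)
    (v : Fin n → V) : (fun j => value (updateAssignment s x a) (Fin.cons (α := fun _ => V) x v j)) =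
      fun j => Sum.elim (fun j => value s (v j)) (fun _ => a) (updateIndex x v j) := by
  classical
  funext j
  refine Fin.cases ?_ (fun j => ?_) j
  · simp [updateIndex, value_updateAssignment]
  · by_cases h : v j = x <;> simp [updateIndex, value_updateAssignment, h]

theorem valueRel_supplementTeam [Nonempty M] {D : Set V} (X : Set (D → M)) (x : V)
    (F : X → Set M) (v : Fin n → V) :
    valueRel (supplementTeam X x F) (Fin.cons (α := fun _ => V) x v) =
      {q | ∃ s : X, ∃ a ∈ F s,
        q = fun j => Sum.elim (fun j => value s.1 (v j)) (fun _ => a) (updateIndex x v j)} := by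
  ext q
  constructor
  · rintro ⟨_, ⟨s, a, ha, rfl⟩, rfl⟩
    exact ⟨s, a, ha, value_updateAssignment_cons _ _ _ _⟩
  · rintro ⟨s, a, ha, rfl⟩
    exact ⟨_, ⟨s, a, ha, rfl⟩, value_updateAssignment_cons _ _ _ _⟩

theorem valueRel_duplicateTeam [Nonempty M] {D : Set V} (X : Set (D → M)) (x : V) (v : Fin n → V) :
    valueRel (duplicateTeam X x) (Fin.cons (α := fun _ => V) x v) =
      {q | ∃ r ∈ valueRel X v, ∃ a : Unit → M, q = fun j => Sum.elim r a (updateIndex x v j)} := by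
  ext q
  constructor
  · rintro ⟨_, ⟨s, hs, a, rfl⟩, rfl⟩
    exact ⟨_, ⟨s, hs, rfl⟩, fun _ => a, value_updateAssignment_cons _ _ _ _⟩
  · rintro ⟨_, ⟨s, hs, rfl⟩, a, rfl⟩
    exact ⟨_, ⟨s, hs, a (), rfl⟩, value_updateAssignment_cons _ _ _ _⟩

theorem exists_term_realize_eq [DecidableEq V] (t : L.Term V) (v : Fin n → V)
    (h : (t.varFinset : Set V) ⊆ Set.range v) :
    ∃ t' : L.Term (Fin n), ∀ (M : Type u) [L.Structure M] (s : V → M),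
      t.realize s = t'.realize fun j => s (v j) := by
  choose i hi using fun x : t.varFinset => h x.2
  exact ⟨t.restrictVar i, fun M _ s => (Term.realize_restrictVar s fun a => by rw [hi]).symm⟩

namespace FOFormula

variable {C : Set DepAtom}

/-- `φ` is expressed by an existential second-order property of the relation
`{(s v₀, …, s vₙ₋₁) | s ∈ X}`. -/
def IsESOIn (φ : FOFormula L V C) (v : Fin n → V) : Prop :=
  ∃ P : ∀ (M : Type u) [L.Structure M] [Nonempty M], (Unit → Set (Fin n → M)) → Prop,
    IsESO L (fun _ : Unit => n) P ∧ ∀ (M : Type u) [L.Structure M] [Nonempty M] (D : Set V)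
      (X : Set (D → M)), φ.Sat X ↔ P M fun _ => valueRel X v

/-- Two relations covering `X[v]` pull back to two subteams covering `X`. Overlap is permitted by
lax semantics, and satisfaction depends only on the relations. -/
theorem isESOIn_or {φ ψ : FOFormula L V C} {v : Fin n → V} (hφ : φ.IsESOIn v)
    (hψ : ψ.IsESOIn v) : (φ.or ψ).IsESOIn v := by
  obtain ⟨P, hP, hφ⟩ := hφ
  obtain ⟨Q, hQ, hψ⟩ := hψ
  refine ⟨_, IsESO.exists (ar := fun _ : Unit => n) (ar' := fun _ : Bool => n)
    (isFO_union.isESO.and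
    ((hP.comap (fun _ => .inr false) (fun _ => rfl)).and
      (hQ.comap (fun _ => .inr true) (fun _ => rfl)))), fun M _ _ D X => ?_⟩
  constructor
  · rintro ⟨Y, Z, -, -, rfl, hY, hZ⟩
    refine ⟨fun b => cond b (valueRel Z v) (valueRel Y v), ?_, (hφ M D Y).1 hY, (hψ M D Z).1 hZ⟩
    exact (Set.image_union _ _ _).symm
  · rintro ⟨T, hT, hY, hZ⟩
    change T false ∪ T true = valueRel X v at hT
    have key (b : Bool) (hb : T b ⊆ valueRel X v) :
        valueRel {s ∈ X | (fun j => value s (v j)) ∈ T b} v = T b := by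
      ext r
      constructor
      · rintro ⟨s, ⟨-, hs⟩, rfl⟩
        exact hs
      · intro hr
        obtain ⟨s, hs, rfl⟩ := hb hr
        exact ⟨s, ⟨hs, hr⟩, rfl⟩
    refine ⟨{s ∈ X | (fun j => value s (v j)) ∈ T false}, {s ∈ X | (fun j => value s (v j)) ∈ T true},
      fun s hs => hs.1, fun s hs => hs.1, ?_, (hφ _ _ _).2 ?_, (hψ _ _ _).2 ?_⟩
    · ext s
      refine ⟨fun hs => hs.elim (·.1) (·.1), fun hs => ?_⟩
      have : (fun j => value s (v j)) ∈ T false ∪ T true := hT ▸ ⟨s, hs, rfl⟩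
      exact this.imp (⟨hs, ·⟩) (⟨hs, ·⟩)
    · rw [key _ (hT ▸ Set.subset_union_left)]
      exact hY
    · rw [key _ (hT ▸ Set.subset_union_right)]
      exact hZ

/-- The quantified relation `T` codes the supplemented team. It is realized by letting `F s` consist
of all values that extend the tuple of `s` into `T`, which uses that lax choices are sets of values.
-/
theorem isESOIn_ex {φ : FOFormula L V C} {x : V} {v : Fin n → V}
    (hφ : φ.IsESOIn (Fin.cons (α := fun _ => V) x v)) : (φ.ex x).IsESOIn v := by
  obtain ⟨P, hP, hφ⟩ := hφ
  refine ⟨_, IsESO.exists (ar := fun _ : Unit => n) (ar' := fun _ : Unit => n + 1)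
    ((isFO_exists_extension (updateIndex x v)).isESO.and
    ((isFO_isExtension (updateIndex x v)).isESO.and
      (hP.comap (fun _ => .inr ()) (fun _ => rfl)))), fun M _ _ D X => ?_⟩
  constructor
  · rintro ⟨F, hF, h⟩
    refine ⟨fun _ => valueRel (supplementTeam X x F) (Fin.cons (α := fun _ => V) x v), ?_, ?_,
      (hφ _ _ _).1 h⟩
    · rintro _ ⟨s, hs, rfl⟩
      obtain ⟨a, ha⟩ := hF ⟨s, hs⟩
      refine ⟨fun _ => a, ?_⟩
      change _ ∈ valueRel _ _
      rw [valueRel_supplementTeam]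
      exact ⟨⟨s, hs⟩, a, ha, rfl⟩
    · intro q hq
      change _ ∈ valueRel _ _ at hq
      rw [valueRel_supplementTeam] at hq
      obtain ⟨s, a, -, rfl⟩ := hq
      exact ⟨_, ⟨s.1, s.2, rfl⟩, fun _ => a, rfl⟩
  · rintro ⟨T, h₁, h₂, h₃⟩
    refine ⟨fun s => {a | (fun j => Sum.elim (fun j => value s.1 (v j)) (fun _ => a)
      (updateIndex x v j)) ∈ T ()}, fun s => ?_, (hφ _ _ _).2 ?_⟩
    · obtain ⟨a, ha⟩ := h₁ _ ⟨s.1, s.2, rfl⟩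
      exact ⟨a (), ha⟩
    · rw [valueRel_supplementTeam]
      refine (congrArg (P M) (funext fun _ => ?_)).mpr h₃
      ext q
      constructor
      · rintro ⟨s, a, ha, rfl⟩
        exact ha
      · intro hq
        obtain ⟨_, ⟨s, hs, rfl⟩, a, rfl⟩ := h₂ q hq
        exact ⟨⟨s, hs⟩, a (), hq, rfl⟩

/-- The two first-order conditions determine `T` as the relation of the duplicate team; it is
quantified only so that `P` can be applied to it. -/
theorem isESOIn_all {φ : FOFormula L V C} {x : V} {v : Fin n → V}
    (hφ : φ.IsESOIn (Fin.cons (α := fun _ => V) x v)) : (φ.all x).IsESOIn v := by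
  obtain ⟨P, hP, hφ⟩ := hφ
  refine ⟨_, IsESO.exists (ar := fun _ : Unit => n) (ar' := fun _ : Unit => n + 1)
    ((isFO_forall_extension (updateIndex x v)).isESO.and
    ((isFO_isExtension (updateIndex x v)).isESO.and
      (hP.comap (fun _ => .inr ()) (fun _ => rfl)))), fun M _ _ D X => ?_⟩
  refine (hφ _ _ _).trans ?_
  rw [valueRel_duplicateTeam]
  constructor
  · intro h
    exact ⟨fun _ => {q | ∃ r ∈ valueRel X v, ∃ a : Unit → M,
      q = fun j => Sum.elim r a (updateIndex x v j)}, fun r hr a => ⟨r, hr, a, rfl⟩, fun q hq => hq, h⟩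
  · rintro ⟨T, h₁, h₂, h₃⟩
    refine (congrArg (P M) (funext fun _ => ?_)).mpr h₃
    ext q
    constructor
    · rintro ⟨r, hr, a, rfl⟩
      exact h₁ r hr a
    · exact h₂ q

/-- The induction needs any tuple covering the free variables, possibly with repetitions or extra
variables: subformulas have fewer variables, and a quantifier prepends `x` even if `x` already
occurs in `v`. -/
theorem isESOIn (φ : FOFormula L V C) :
    ∀ {n : ℕ} (v : Fin n → V), (φ.fv : Set V) ⊆ Set.range v → φ.IsESOIn v := by
  classical
  induction φ with
  | eq t t' =>
    intro n v h
    simp only [fv, Finset.coe_union, Set.union_subset_iff] at h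
    obtain ⟨r, hr⟩ := exists_term_realize_eq t v h.1
    obtain ⟨r', hr'⟩ := exists_term_realize_eq t' v h.2
    refine ⟨_, (isFO_eq r r').isESO, fun M _ _ D X => ?_⟩
    simp only [Sat, valueRel, Set.forall_mem_image, hr, hr']
  | neq t t' =>
    intro n v h
    simp only [fv, Finset.coe_union, Set.union_subset_iff] at h
    obtain ⟨r, hr⟩ := exists_term_realize_eq t v h.1
    obtain ⟨r', hr'⟩ := exists_term_realize_eq t' v h.2
    refine ⟨_, (isFO_neq r r').isESO, fun M _ _ D X => ?_⟩
    simp only [Sat, valueRel, Set.forall_mem_image, hr, hr']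
  | rel R t =>
    intro n v h
    simp only [fv, Finset.coe_biUnion, Finset.coe_univ, Set.mem_univ, Set.iUnion_true,
      Set.iUnion_subset_iff] at h
    choose r hr using fun i => exists_term_realize_eq (t i) v (h i)
    refine ⟨_, (isFO_rel R r).isESO, fun M _ _ D X => ?_⟩
    simp only [Sat, valueRel, Set.forall_mem_image, hr]
  | nrel R t =>
    intro n v h
    simp only [fv, Finset.coe_biUnion, Finset.coe_univ, Set.mem_univ, Set.iUnion_true,
      Set.iUnion_subset_iff] at h
    choose r hr using fun i => exists_term_realize_eq (t i) v (h i)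
    refine ⟨_, (isFO_nrel R r).isESO, fun M _ _ D X => ?_⟩
    simp only [Sat, valueRel, Set.forall_mem_image, hr]
  | dep hC x y =>
    intro n v h
    simp only [fv, Finset.coe_insert, Finset.coe_image, Finset.coe_univ, Set.image_univ,
      Set.insert_subset_iff, Set.range_subset_iff] at h
    obtain ⟨⟨y', rfl⟩, hx⟩ := h
    choose x' hx using hx
    refine ⟨_, (isFO_dep x' y').isESO, fun M _ _ D X => ?_⟩
    simp only [Sat, valueRel, Set.forall_mem_image, hx]
  | indep hC x z y =>
    intro n v h
    simp only [fv, Finset.coe_union, Finset.coe_image, Finset.coe_univ, Set.image_univ,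
      Set.union_subset_iff, Set.range_subset_iff] at h
    obtain ⟨⟨hx, hz⟩, hy⟩ := h
    choose x' hx using hx
    choose y' hy using hy
    choose z' hz using hz
    refine ⟨_, (isFO_indep x' z' y').isESO, fun M _ _ D X => ?_⟩
    simp only [Sat, valueRel, Set.forall_mem_image, Set.exists_mem_image, hx, hy, hz]
  | incl hC x y =>
    intro n v h
    simp only [fv, Finset.coe_union, Finset.coe_image, Finset.coe_univ, Set.image_univ,
      Set.union_subset_iff, Set.range_subset_iff] at h
    obtain ⟨hx, hy⟩ := h
    choose x' hx using hx
    choose y' hy using hy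
    refine ⟨_, (isFO_incl x' y').isESO, fun M _ _ D X => ?_⟩
    simp only [Sat, valueRel, Set.forall_mem_image, Set.exists_mem_image, hx, hy]
  | excl hC x y =>
    intro n v h
    simp only [fv, Finset.coe_union, Finset.coe_image, Finset.coe_univ, Set.image_univ,
      Set.union_subset_iff, Set.range_subset_iff] at h
    obtain ⟨hx, hy⟩ := h
    choose x' hx using hx
    choose y' hy using hy
    refine ⟨_, (isFO_excl x' y').isESO, fun M _ _ D X => ?_⟩
    simp only [Sat, valueRel, Set.forall_mem_image, hx, hy]
  | and φ ψ ihφ ihψ =>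
    intro n v h
    simp only [fv, Finset.coe_union, Set.union_subset_iff] at h
    obtain ⟨P, hP, hφ⟩ := ihφ v h.1
    obtain ⟨Q, hQ, hψ⟩ := ihψ v h.2
    exact ⟨_, hP.and hQ, fun M _ _ D X => and_congr (hφ M D X) (hψ M D X)⟩
  | or φ ψ ihφ ihψ =>
    intro n v h
    simp only [fv, Finset.coe_union, Set.union_subset_iff] at h
    exact isESOIn_or (ihφ v h.1) (ihψ v h.2)
  | ex x φ ih =>
    intro n v h
    refine isESOIn_ex (ih _ ?_)
    rw [Fin.range_cons]
    simpa only [fv, Finset.coe_erase, Set.sdiff_singleton_subset_iff] using h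
  | all x φ ih =>
    intro n v h
    refine isESOIn_all (ih _ ?_)
    rw [Fin.range_cons]
    simpa only [fv, Finset.coe_erase, Set.sdiff_singleton_subset_iff] using h

end FOFormula

/-- Every fragment of `FO(C)` admits a translation into existential second-order logic. -/
theorem translatesToESO_fragment_FOLogic (C : Set DepAtom) (F : Set (FOLogic L V C).Form) :
    ((FOLogic L V C).fragment F).TranslatesToESO := by
  intro φ n v _ hv
  obtain ⟨P, hP, hφ⟩ := FOFormula.isESOIn φ.1 v hv.ge
  obtain ⟨χ, hχ⟩ := hP.exists_sentence
  refine ⟨χ, fun M _ _ D h X => (hφ M D X).trans ?_⟩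
  rw [← valueRel_eq_teamRel]
  exact hχ M _

end Translation

end TeamSemantics

theorem mainTheorem2 :
    (∀ (L : FirstOrder.Language.{u, u}) (V : Type u) (𝓛 : TeamSemantics.TeamLogic L V),
      𝓛.IsLocal → 𝓛.TranslatesToESO →
        ∀ Γ : Set 𝓛.Form, 𝓛.FinitelySatisfiable Γ → 𝓛.Satisfiable Γ) ∧
    (∀ (L : FirstOrder.Language.{u, u}) (V : Type u) (C : Set TeamSemantics.DepAtom)
      (F : Set (TeamSemantics.FOLogic L V C).Form),
      ((TeamSemantics.FOLogic L V C).fragment F).IsLocal ∧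
      ((TeamSemantics.FOLogic L V C).fragment F).TranslatesToESO ∧
        ∀ Γ : Set ((TeamSemantics.FOLogic L V C).fragment F).Form,
          ((TeamSemantics.FOLogic L V C).fragment F).FinitelySatisfiable Γ →
            ((TeamSemantics.FOLogic L V C).fragment F).Satisfiable Γ) :=
  ⟨fun _ _ _ _ hT _ hΓ => hT.compactness hΓ, fun _ _ C F =>
    have hT := TeamSemantics.translatesToESO_fragment_FOLogic C F
    ⟨hT.isLocal, hT, fun _ hΓ => hT.compactness hΓ⟩⟩
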